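/- Fix $L,n_0,d\in\mathbb N^*$, constants $C_B\ge 0$, $C_W>0$, a function $\sigma:\mathbb R\to\mathbb R$ (acting componentwise on vectors) and inputs $x(1),\dots,x(d)\in\mathbb R^{n_0}$. For each $\ell=1,\dots,L$ and $n\ge1$ let $V^{(\ell)}_{n,1},\dots,V^{(\ell)}_{n,n}$ be i.i.d. random variables with values in $[0,\infty)$. For $a\ge 0$ and a Borel measure $\rho$ on $(0,\infty)$ with $\int\min\{1,x\}\,\rho(\mathrm dx)<\infty$, let $\mathrm{ID}(a,\rho)$ be the infinitely divisible law with characteristic function $u\mapsto\exp\big(iua+\int_{(0,\infty)}(e^{iux}-1)\,\rho(\mathrm dx)\big)$. Define random $d\times d$ matrices $\mathbf K^{(\ell)}$, $\ell=1,\dots,L+1$, by $$\mathbf K^{(1)}=\Big(C_B+C_W\frac{x(i)^\top x(i')}{n_0}\Big)_{1\le i,i'\le d},$$ $$\mathbf K^{(\ell)}=C_B\mathbf 1_d\mathbf 1_d^\top+C_W\Big(a^{(\ell-1)}\,\mathbb E\big[\sigma(\zeta^{(\ell-1)}_1)\sigma(\zeta^{(\ell-1)}_1)^\top\,\big|\,\mathbf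 K^{(\ell-1)}\big]+\sum_{j=1}^{N_{\ell-1}((0,\infty))}T^{(\ell-1)}_j\,\sigma(\zeta^{(\ell-1)}_j)\sigma(\zeta^{(\ell-1)}_j)^\top\Big),\quad \ell=2,\dots,L+1,$$ where, given $\mathbf K^{(\ell-1)}$: the vectors $\zeta^{(\ell-1)}_1,\zeta^{(\ell-1)}_2,\dots$ are i.i.d. with law $\mathcal N_d(0,\mathbf K^{(\ell-1)})$; $\{T^{(\ell-1)}_j\}_{1\le j\le N_{\ell-1}((0,\infty))}$ are the points of a Poisson process $N_{\ell-1}$ on $(0,\infty)$ with mean measure $\rho^{(\ell-1)}$; and the points are independent of the sequence $(\zeta^{(\ell-1)}_j)_{j\ge1}$. The conditional expectation is the second-moment matrix of $\sigma(\zeta)$ for $\zeta\sim\mathcal N_d(0,\mathbf K^{(\ell-1)})$ with $\mathbf K^{(\ell-1)}$ fixed. Assume: 1. $\sigma$ is continuous, and there are $a_1,a_2,a_3>0$ with $|\sigma(z)|\le a_1+a_2|z|^{a_3}$ for all $z\in\mathbb R$; 2. for each $\ell=1,\dots,L$, $\sum_{j=1}^{n}V^{(\ell)}_{n,j}\to\mathrm{ID}(a^{(\ell)},\rho^{(\ell)})$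 in distribution as $n\to\infty$; 3. there is a Borel set $A\subseteq\mathbb R^d$ such that $A$ and $\sigma(A)=\{\sigma(z):z\in A\}$ both have positive Lebesgue measure; 4. $d\le n_0$, and $x(1),\dots,x(d)$ are linearly independent; 5. for each $\ell\in\{2,\dots,L+1\}$, if $a^{(\ell-1)}=0$ then $N_{\ell-1}((0,\infty))=\infty$ almost surely. Then, almost surely, the series in the definition of $\mathbf K^{(\ell)}$ converges for every $\ell=2,\dots,L+1$, and $\mathbf K^{(L+1)}$ is almost surely positive definite; in particular $\mathbb P(\det\mathbf K^{(L+1)}>0)=1$. -/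

import Mathlib

open MeasureTheory ProbabilityTheory Set Filter Topology
open scoped BoundedContinuousFunction

noncomputable section

namespace WideNet

/-! ### Non-negative infinitely divisible laws and null arrays -/

/-- `μ` is the infinitely divisible law `ID(a, ρ)` of a non-negative random variable: `a ≥ 0`,
`ρ` is a measure concentrated on `(0, ∞)` with `∫ min(1, x) ρ(dx) < ∞`, and the characteristic
function of `μ` is `u ↦ exp (i u a + ∫_{(0,∞)} (e^{iux} - 1) ρ(dx))`. -/
structure IsNonnegID (a : ℝ) (ρ : Measure ℝ) (μ : Measure ℝ) : Prop where
  drift_nonneg : 0 ≤ a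
  levy_support : ρ (Iic 0) = 0
  levy_integrable : ∫⁻ x in Ioi 0, ENNReal.ofReal (min 1 x) ∂ρ < ⊤
  isProbability : IsProbabilityMeasure μ
  charFun_eq : ∀ u : ℝ, charFun μ u =
    Complex.exp (Complex.I * u * a +
      ∫ x in Ioi (0 : ℝ), (Complex.exp (Complex.I * u * x) - 1) ∂ρ)

/-- `V n 1 + ⋯ + V n n → ID(a, ρ)` in distribution as `n → ∞`, where for each `n` the variables
`V n 1, …, V n n` are independent with the common law `M n` on `[0, ∞)`. Their joint law is the
`n`-fold product of `M n`. -/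
def RowSumsTendToID (M : ℕ → ProbabilityMeasure ℝ) (a : ℝ) (ρ : Measure ℝ) : Prop :=
  (∀ n, (M n : Measure ℝ) (Iio 0) = 0) ∧
  ∃ μ : Measure ℝ, IsNonnegID a ρ μ ∧
    ∀ f : ℝ →ᵇ ℝ,
      Tendsto (fun n : ℕ =>
          ∫ v : Fin n → ℝ, f (∑ j, v j) ∂(Measure.pi fun _ : Fin n => (M n : Measure ℝ)))
        atTop (𝓝 (∫ y, f y ∂μ))

/-! ### Poisson processes on `(0, ∞)` -/

/-- A point process on `(0, ∞)` is given by its random number of points `N`, possibly `∞`, and an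
enumeration `T 0, T 1, …` of the points (only the labels `j < N` are used). `pointCount N T B` is
the number of points, counted with multiplicity, that lie in `B`. -/
def pointCount {Ω : Type*} (N : Ω → ℕ∞) (T : ℕ → Ω → ℝ) (B : Set ℝ) (ω : Ω) : ℕ∞ :=
  {j : ℕ | (j : ℕ∞) < N ω ∧ T j ω ∈ B}.encard

/-- `(T j)_{j < N}` are the points of a Poisson process on `(0, ∞)` with mean measure `ρ`: the
number of points in `B` has the Poisson law with mean `ρ B` (it is a.s. infinite if `ρ B = ∞`),
and the numbers of points in pairwise disjoint sets are independent. -/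
structure IsPoissonProcess {Ω : Type*} [MeasurableSpace Ω] (P : Measure Ω)
    (N : Ω → ℕ∞) (T : ℕ → Ω → ℝ) (ρ : Measure ℝ) : Prop where
  measurable_N : Measurable N
  measurable_T : ∀ j, Measurable (T j)
  pos : ∀ ω (j : ℕ), (j : ℕ∞) < N ω → 0 < T j ω
  law : ∀ B, MeasurableSet B → B ⊆ Ioi 0 → ρ B ≠ ⊤ → ∀ n : ℕ,
    P {ω | pointCount N T B ω = n} = poissonMeasure (ρ B).toNNReal {n}
  law_top : ∀ B, MeasurableSet B → B ⊆ Ioi 0 → ρ B = ⊤ → ∀ᵐ ω ∂P, pointCount N T B ω = ⊤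
  indep : ∀ (k : ℕ) (B : Fin k → Set ℝ), (∀ i, MeasurableSet (B i)) → (∀ i, B i ⊆ Ioi 0) →
    Pairwise (Function.onFun Disjoint B) → iIndepFun (fun i => pointCount N T (B i)) P

/-! ### The limiting covariance matrices -/

/-- The activation function acting componentwise on vectors. -/
def act {d : ℕ} (σ : ℝ → ℝ) (z : EuclideanSpace ℝ (Fin d)) : EuclideanSpace ℝ (Fin d) :=
  WithLp.toLp 2 fun i => σ (z i)

/-- The rank-one matrix `σ(z) σ(z)ᵀ`. -/
def actOuter {d : ℕ} (σ : ℝ → ℝ) (z : EuclideanSpace ℝ (Fin d)) : Matrix (Fin d) (Fin d) ℝ :=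
  Matrix.of fun i i' => act σ z i * act σ z i'

/-- The matrix `E[σ(ζ) σ(ζ)ᵀ]` for `ζ ∼ N_d(0, K)`. With `K` a random matrix and `ζ` distributed as
`N_d(0, K)` given `K`, this is the value of the conditional expectation `E[σ(ζ) σ(ζ)ᵀ | K]`. -/
def gaussOuter {d : ℕ} (σ : ℝ → ℝ) (K : Matrix (Fin d) (Fin d) ℝ) : Matrix (Fin d) (Fin d) ℝ :=
  Matrix.of fun i i' => ∫ z, actOuter σ z i i' ∂(multivariateGaussian 0 K)

/-- The first covariance matrix, with entries `C_B + C_W ⟨x(i), x(i')⟩ / n₀`. -/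
def covFirst {n₀ d : ℕ} (CB CW : ℝ) (x : Fin d → EuclideanSpace ℝ (Fin n₀)) :
    Matrix (Fin d) (Fin d) ℝ :=
  Matrix.of fun i i' => CB + CW * (inner ℝ (x i) (x i') / n₀)

/-- The terms `T_j σ(ζ_j) σ(ζ_j)ᵀ`, `j < N`, of the random series at one layer. -/
def jumpTerm {Ω : Type*} {d : ℕ} (σ : ℝ → ℝ) (N : Ω → ℕ∞) (T : ℕ → Ω → ℝ)
    (ζ : ℕ → Ω → EuclideanSpace ℝ (Fin d)) (ω : Ω) (j : {j : ℕ // (j : ℕ∞) < N ω}) :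
    Matrix (Fin d) (Fin d) ℝ :=
  T j ω • actOuter σ (ζ j ω)

/-- The random matrices `K^{(ℓ)}(x)`, `ℓ ≥ 1`, given by the stochastic recurrence
`K^{(ℓ)} = C_B 1 1ᵀ + C_W (a^{(ℓ-1)} E[σ(ζ₁^{(ℓ-1)}) σ(ζ₁^{(ℓ-1)})ᵀ | K^{(ℓ-1)}]
  + ∑_j T_j^{(ℓ-1)} σ(ζ_j^{(ℓ-1)}) σ(ζ_j^{(ℓ-1)})ᵀ)`. The index `0` is not used. -/
def cov {Ω : Type*} {n₀ d : ℕ} (CB CW : ℝ) (σ : ℝ → ℝ) (x : Fin d → EuclideanSpace ℝ (Fin n₀))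
    (a : ℕ → ℝ) (N : ℕ → Ω → ℕ∞) (T : ℕ → ℕ → Ω → ℝ)
    (ζ : ℕ → ℕ → Ω → EuclideanSpace ℝ (Fin d)) : ℕ → Ω → Matrix (Fin d) (Fin d) ℝ
  | 0, _ => 0
  | 1, _ => covFirst CB CW x
  | ℓ + 2, ω =>
      CB • Matrix.of (fun _ _ => (1 : ℝ)) +
        CW • (a (ℓ + 1) • gaussOuter σ (cov CB CW σ x a N T ζ (ℓ + 1) ω) +
          ∑' j, jumpTerm σ (N (ℓ + 1)) (T (ℓ + 1)) (ζ (ℓ + 1)) ω j)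

/-- The random inputs of one step of the recurrence, where `K` is the current random covariance
matrix. Given `K`: the `(T j)_{j < N}` are the points of a Poisson process on `(0, ∞)` with mean
measure `ρ`; the `ζ j` are independent with law `N_d(0, K)`; the sequence `ζ` is independent of
the enumerated points.

Since the conditional law of the Poisson process given `K` does not depend on `K`, the first clause
says that the process is Poisson and independent of `K`. The other two clauses together say that
the conditional law of `ζ` given `(K, N, T)` is the infinite product of the laws `N_d(0, K)`, which
is expressed here through the conditional probabilities of all cylinder events. -/
structure IsLayerInput {Ω : Type*} [mΩ : MeasurableSpace Ω] (P : Measure Ω) {d : ℕ}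
    (K : Ω → Matrix (Fin d) (Fin d) ℝ) (ρ : Measure ℝ) (N : Ω → ℕ∞) (T : ℕ → Ω → ℝ)
    (ζ : ℕ → Ω → EuclideanSpace ℝ (Fin d)) : Prop where
  poisson : IsPoissonProcess P N T ρ
  poisson_indep : IndepFun
    (fun ω (B : {B : Set ℝ // MeasurableSet B}) => pointCount N T B ω) (fun ω i i' => K ω i i') P
  measurable_ζ : ∀ j, Measurable (ζ j)
  gaussian : ∀ (s : Finset ℕ) (C : ℕ → Set (EuclideanSpace ℝ (Fin d))),
    (∀ j, MeasurableSet (C j)) →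
    P⟦⋂ j ∈ s, ζ j ⁻¹' C j |
        MeasurableSpace.comap (fun ω => ((fun i i' => K ω i i'), N ω, fun j => T j ω))
          (inferInstance : MeasurableSpace ((Fin d → Fin d → ℝ) × ℕ∞ × (ℕ → ℝ)))⟧
      =ᵐ[P] fun ω => ∏ j ∈ s, (multivariateGaussian 0 (K ω)).real (C j)

end WideNet

end

open scoped RealInnerProductSpace MatrixOrder ENNReal NNReal

namespace WideNet

/-! Positive definiteness propagates almost surely from layer to layer, starting from `covFirst`,
which is a positive semidefinite matrix plus a positive multiple of the Gram matrix of independent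
vectors.

Let `K` be positive definite. Then N(0, K) charges every nonempty open set. The values of `act σ`
lie in no hyperplane, since their range has positive volume, so for each v ≠ 0 the function z ↦ ⟨v,
σ(z)⟩ is nonzero on a nonempty open set. If a > 0, integrating its square makes the drift term
positive definite (`posDef_gaussOuter`). If a = 0, all labels carry points, and the Gaussian
sequence visits any given nonempty open set almost surely. Compactness of the unit sphere reduces
all directions v to finitely many such sets (`exists_finite_open_cover`), so the exceptional null
set does not depend on v. `ae_posDef_step` joins the two cases.

Convergence of the series rests on two facts: ∑ min(1, T_j) is finite almost surely, its mean being
at most ∫ min(1, x) ρ(dx), and, given (K, N, T), the variables |σ(ζ_j)|² have a common finite mean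
(`ae_tsum_mul_lt_top`). -/

/-! ### Gaussian laws charge open sets. -/

theorem isOpenPosMeasure_stdGaussian {ι : Type*} [Fintype ι] :
    (stdGaussian (EuclideanSpace ℝ ι)).IsOpenPosMeasure := by
  rw [← map_pi_eq_stdGaussian]
  have : (gaussianReal 0 1).IsOpenPosMeasure :=
    (gaussianReal_absolutelyContinuous' 0 one_ne_zero).isOpenPosMeasure
  exact (PiLp.continuous_toLp 2 _).isOpenPosMeasure_map (WithLp.toLp_surjective 2)

/-- The square root of an invertible matrix is invertible, so N(μ, K) is the image of the standard
Gaussian under a continuous surjective affine map. -/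
theorem isOpenPosMeasure_multivariateGaussian {ι : Type*} [Fintype ι] [DecidableEq ι]
    (μ : EuclideanSpace ℝ ι) {K : Matrix ι ι ℝ} (hK : K.PosDef) :
    (multivariateGaussian μ K).IsOpenPosMeasure := by
  have hmul : CFC.sqrt K * CFC.sqrt K = K := CFC.sqrt_mul_sqrt_self _ hK.posSemidef.nonneg
  have hunit : IsUnit (CFC.sqrt K) := by
    have h := hK.isUnit
    rw [← hmul] at h
    exact isUnit_of_mul_isUnit_left h
  have hu2 := hunit.map (Matrix.toEuclideanCLM (n := ι) (𝕜 := ℝ))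
  obtain ⟨S, hS⟩ := hu2.exists_right_inv
  have := isOpenPosMeasure_stdGaussian (ι := ι)
  rw [multivariateGaussian]
  refine Continuous.isOpenPosMeasure_map (by fun_prop) fun y => ⟨S (y - μ), ?_⟩
  have := congrArg (fun A => A (y - μ)) hS
  simp only [mul_apply_eq_comp, one_apply_eq_self] at this
  rw [this, add_sub_cancel]

/-! ### The activation under Gaussian laws: moments and nondegeneracy. -/

variable {d : ℕ} {σ : ℝ → ℝ}

/-- An activation function of polynomial growth is square integrable against Gaussian laws. -/
theorem memLp_activation (hσ : Continuous σ)
    (hgrowth : ∃ a₁ a₂ a₃ : ℝ, 0 < a₁ ∧ 0 < a₂ ∧ 0 < a₃ ∧ ∀ z : ℝ, |σ z| ≤ a₁ + a₂ * |z| ^ a₃)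
    (K : Matrix (Fin d) (Fin d) ℝ) (i : Fin d) :
    MemLp (fun z : EuclideanSpace ℝ (Fin d) => σ (z i)) 2 (multivariateGaussian 0 K) := by
  obtain ⟨a₁, a₂, a₃, h1, h2, h3, hb⟩ := hgrowth
  -- The norm in L^(2 a₃) is the same as its a₃-th power in L².
  have hid := IsGaussian.memLp_id (multivariateGaussian (0 : EuclideanSpace ℝ (Fin d)) K)
    (2 * ENNReal.ofReal a₃) (ENNReal.mul_ne_top (by simp) (by simp))
  have hpow := hid.norm_rpow_div (ENNReal.ofReal a₃)
  rw [ENNReal.mul_div_cancel_right (by simpa using h3) (by simp),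
    ENNReal.toReal_ofReal h3.le] at hpow
  refine ((memLp_const a₁).add (hpow.const_mul a₂)).mono' (by fun_prop) (ae_of_all _ fun z => ?_)
  refine (hb (z i)).trans ?_
  have : |z i| ≤ ‖z‖ := PiLp.norm_apply_le z i
  simp only [Pi.add_apply, id]
  gcongr

theorem memLp_inner_act (hσ : Continuous σ)
    (hgrowth : ∃ a₁ a₂ a₃ : ℝ, 0 < a₁ ∧ 0 < a₂ ∧ 0 < a₃ ∧ ∀ z : ℝ, |σ z| ≤ a₁ + a₂ * |z| ^ a₃)
    (K : Matrix (Fin d) (Fin d) ℝ) (v : Fin d → ℝ) :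
    MemLp (fun z : EuclideanSpace ℝ (Fin d) => ∑ i, v i * σ (z i)) 2
      (multivariateGaussian 0 K) :=
  memLp_finsetSum _ fun i _ => (memLp_activation hσ hgrowth K i).const_mul (v i)

theorem quadForm_actOuter (v : Fin d → ℝ) (z : EuclideanSpace ℝ (Fin d)) :
    v ⬝ᵥ (actOuter σ z).mulVec v = (∑ i, v i * σ (z i)) ^ 2 := by
  simp only [dotProduct, Matrix.mulVec, actOuter, act, Matrix.of_apply, Finset.mul_sum]
  rw [sq, Finset.sum_mul_sum]
  exact Finset.sum_congr rfl fun i _ => Finset.sum_congr rfl fun j _ => by ring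

theorem posSemidef_actOuter (z : EuclideanSpace ℝ (Fin d)) : (actOuter σ z).PosSemidef := by
  refine .of_dotProduct_mulVec_nonneg (Matrix.IsHermitian.ext fun i j => ?_) fun v => ?_
  · simp [actOuter, mul_comm]
  · rw [star_trivial, quadForm_actOuter]
    positivity

theorem quadForm_gaussOuter (hσ : Continuous σ)
    (hgrowth : ∃ a₁ a₂ a₃ : ℝ, 0 < a₁ ∧ 0 < a₂ ∧ 0 < a₃ ∧ ∀ z : ℝ, |σ z| ≤ a₁ + a₂ * |z| ^ a₃)
    (K : Matrix (Fin d) (Fin d) ℝ) (v : Fin d → ℝ) :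
    v ⬝ᵥ (gaussOuter σ K).mulVec v =
      ∫ z, (∑ i, v i * σ (z i)) ^ 2 ∂(multivariateGaussian 0 K) := by
  have hint (i j) : Integrable (fun z : EuclideanSpace ℝ (Fin d) => actOuter σ z i j)
      (multivariateGaussian 0 K) :=
    (memLp_activation hσ hgrowth K i).integrable_mul (memLp_activation hσ hgrowth K j)
  simp_rw [← quadForm_actOuter]
  simp only [dotProduct, Matrix.mulVec, gaussOuter, Matrix.of_apply, Finset.mul_sum]
  rw [integral_finsetSum _ fun i _ => integrable_finsetSum _ fun j _ =>
    ((hint i j).mul_const _).const_mul _]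
  refine Finset.sum_congr rfl fun i _ => ?_
  rw [integral_finsetSum _ fun j _ => ((hint i j).mul_const _).const_mul _]
  refine Finset.sum_congr rfl fun j _ => ?_
  rw [integral_const_mul, integral_mul_const]

theorem isHermitian_gaussOuter (K : Matrix (Fin d) (Fin d) ℝ) : (gaussOuter σ K).IsHermitian :=
  Matrix.IsHermitian.ext fun i j => by simp [gaussOuter, actOuter, mul_comm]

/-- If the image of some set under the activation has positive volume, no hyperplane contains
all the values of the activation. -/
theorem exists_inner_act_ne_zero {A : Set (EuclideanSpace ℝ (Fin d))}
    (hA : 0 < volume (act σ '' A)) {v : Fin d → ℝ} (hv : v ≠ 0) :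
    ∃ z : EuclideanSpace ℝ (Fin d), ∑ i, v i * σ (z i) ≠ 0 := by
  by_contra! h
  let φ : EuclideanSpace ℝ (Fin d) →ₗ[ℝ] ℝ := (innerSL ℝ (WithLp.toLp 2 v)).toLinearMap
  have hφ (y : EuclideanSpace ℝ (Fin d)) : φ y = ∑ i, v i * y i := by
    simp [φ, PiLp.inner_apply, mul_comm]
  have hker : LinearMap.ker φ ≠ ⊤ := by
    intro htop
    have hmem : WithLp.toLp 2 v ∈ LinearMap.ker φ := by rw [htop]; trivial
    have : ⟪WithLp.toLp 2 v, WithLp.toLp 2 v⟫ = 0 := hmem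
    rw [inner_self_eq_zero] at this
    exact hv (by simpa using this)
  refine hA.ne' (measure_mono_null ?_ (Measure.addHaar_submodule volume _ hker))
  rintro _ ⟨z, -, rfl⟩
  rw [SetLike.mem_coe, LinearMap.mem_ker, hφ]
  exact h z

/-- The quadratic form at v is the integral of the continuous function ⟨v, σ(z)⟩² ≥ 0, which is
nonzero somewhere, against a law that charges open sets. -/
theorem posDef_gaussOuter (hσ : Continuous σ)
    (hgrowth : ∃ a₁ a₂ a₃ : ℝ, 0 < a₁ ∧ 0 < a₂ ∧ 0 < a₃ ∧ ∀ z : ℝ, |σ z| ≤ a₁ + a₂ * |z| ^ a₃)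
    {A : Set (EuclideanSpace ℝ (Fin d))} (hA : 0 < volume (act σ '' A))
    {K : Matrix (Fin d) (Fin d) ℝ} (hK : K.PosDef) : (gaussOuter σ K).PosDef := by
  refine .of_dotProduct_mulVec_pos (isHermitian_gaussOuter K) fun v hv => ?_
  have := isOpenPosMeasure_multivariateGaussian 0 hK
  rw [star_trivial, quadForm_gaussOuter hσ hgrowth]
  obtain ⟨z, hz⟩ := exists_inner_act_ne_zero hA hv
  exact integral_pos_of_integrable_nonneg_nonzero (x := z) (by fun_prop)
    (memLp_inner_act hσ hgrowth K v).integrable_sq (fun _ => sq_nonneg _) (pow_ne_zero 2 hz)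

/-- Finitely many open sets such that each nonzero vector fails to be orthogonal to the
activations of all points of one of them. -/
theorem exists_finite_open_cover (hσ : Continuous σ)
    {A : Set (EuclideanSpace ℝ (Fin d))} (hA : 0 < volume (act σ '' A)) :
    ∃ (t : Finset (EuclideanSpace ℝ (Fin d)))
      (U : EuclideanSpace ℝ (Fin d) → Set (EuclideanSpace ℝ (Fin d))),
      (∀ u ∈ t, IsOpen (U u) ∧ (U u).Nonempty) ∧
      ∀ v : Fin d → ℝ, v ≠ 0 → ∃ u ∈ t, ∀ z ∈ U u, ∑ i, v i * σ (z i) ≠ 0 := by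
  have key (v : EuclideanSpace ℝ (Fin d)) (hv : v ∈ Metric.sphere (0 : EuclideanSpace ℝ (Fin d)) 1) :
      ∃ W ∈ 𝓝 v, ∃ U : Set (EuclideanSpace ℝ (Fin d)), IsOpen U ∧ U.Nonempty ∧
        ∀ w ∈ W, ∀ z ∈ U, ∑ i, w i * σ (z i) ≠ 0 := by
    have hv0 : (v : Fin d → ℝ) ≠ 0 := by
      intro h0
      have : v = 0 := by ext i; exact congrFun h0 i
      simp [this] at hv
    obtain ⟨z, hz⟩ := exists_inner_act_ne_zero hA hv0
    -- Nonvanishing is open jointly in direction and point, so one open set of points serves a whole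
    -- neighbourhood of directions.
    have hopen : IsOpen {p : EuclideanSpace ℝ (Fin d) × EuclideanSpace ℝ (Fin d) |
        ∑ i, p.1 i * σ (p.2 i) ≠ 0} :=
      isOpen_ne_fun (by fun_prop) continuous_const
    obtain ⟨W, U, hW, hU, hvW, hzU, hsub⟩ := isOpen_prod_iff.1 hopen v z hz
    exact ⟨W, hW.mem_nhds hvW, U, hU, ⟨z, hzU⟩, fun w hw z hz => hsub (mk_mem_prod hw hz)⟩
  choose! W hW U hUo hUn hWU using key
  obtain ⟨t, ht, hcov⟩ := (isCompact_sphere (0 : EuclideanSpace ℝ (Fin d)) 1).elim_nhds_subcover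
    W hW
  refine ⟨t, U, fun u hu => ⟨hUo u (ht u hu), hUn u (ht u hu)⟩, fun v hv => ?_⟩
  have hv' : WithLp.toLp 2 v ≠ 0 := by simpa using hv
  have hmem : (‖WithLp.toLp 2 v‖⁻¹ • WithLp.toLp 2 v : EuclideanSpace ℝ (Fin d)) ∈
      Metric.sphere (0 : EuclideanSpace ℝ (Fin d)) 1 := by
    simp [norm_smul, hv']
  obtain ⟨u, hu, hvu⟩ := mem_iUnion₂.1 (hcov hmem)
  refine ⟨u, hu, fun z hz h0 => hWU u (ht u hu) _ hvu z hz ?_⟩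
  simp [mul_assoc, ← Finset.mul_sum, h0]

/-- The σ-algebra generated by a random matrix and an enumerated point process. -/
abbrev layerSigma {Ω : Type*} {d : ℕ} (K : Ω → Matrix (Fin d) (Fin d) ℝ) (N : Ω → ℕ∞)
    (T : ℕ → Ω → ℝ) : MeasurableSpace Ω :=
  MeasurableSpace.comap (fun ω => ((fun i i' => K ω i i'), N ω, fun j => T j ω))
    (inferInstance : MeasurableSpace ((Fin d → Fin d → ℝ) × ℕ∞ × (ℕ → ℝ)))

/-- The weight `min (1, T j)` of the `j`-th point, zero for unused labels. -/
noncomputable def weight {Ω : Type*} (N : Ω → ℕ∞) (T : ℕ → Ω → ℝ) (j : ℕ) : Ω → ℝ≥0∞ :=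
  {ω | (j : ℕ∞) < N ω}.indicator fun ω => ENNReal.ofReal (min 1 (T j ω))

/-! ### Campbell's bound for the points of a Poisson process. -/

section Points

variable {Ω : Type*} [MeasurableSpace Ω] {P : Measure Ω} {N : Ω → ℕ∞} {T : ℕ → Ω → ℝ}
  {ρ : Measure ℝ}

theorem tsum_poissonMeasure_singleton (r : ℝ≥0) : ∑' n : ℕ, poissonMeasure r {n} = 1 := by
  rw [← measure_univ (μ := poissonMeasure r), ← Set.iUnion_of_singleton ℕ]
  exact (measure_iUnion (fun i j hij => by simpa using hij)
    fun i => measurableSet_singleton i).symm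

/-- The mean of the Poisson law comes from the shift (n + 1) p(n + 1) = r p(n). -/
theorem tsum_natCast_mul_poissonMeasure (r : ℝ≥0) :
    ∑' n : ℕ, (n : ℝ≥0∞) * poissonMeasure r {n} = r := by
  have hterm (n : ℕ) : ((n + 1 : ℕ) : ℝ≥0∞) * poissonMeasure r {n + 1} =
      r * poissonMeasure r {n} := by
    rw [poissonMeasure_singleton, poissonMeasure_singleton, ← ENNReal.ofReal_coe_nnreal (p := r),
      ← ENNReal.ofReal_natCast, ← ENNReal.ofReal_mul (by positivity),
      ← ENNReal.ofReal_mul (by positivity)]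
    congr 1
    rw [Nat.factorial_succ]
    push_cast
    field_simp
    ring
  rw [tsum_eq_zero_add' ENNReal.summable]
  simp_rw [hterm]
  rw [ENNReal.tsum_mul_left]
  simp [tsum_poissonMeasure_singleton]

/-- The mean measure of the points of a point process. -/
noncomputable def intensity (P : Measure Ω) (N : Ω → ℕ∞) (T : ℕ → Ω → ℝ) : Measure ℝ :=
  Measure.sum fun j : ℕ => (P.restrict {ω | (j : ℕ∞) < N ω}).map (T j)

theorem coe_encard_eq_tsum (s : Set ℕ) :
    ((s.encard : ℕ∞) : ℝ≥0∞) = ∑' j, s.indicator (fun _ => (1 : ℝ≥0∞)) j := by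
  rw [← tsum_subtype, ENNReal.tsum_set_one]

theorem IsPoissonProcess.measurableSet_lt (h : IsPoissonProcess P N T ρ) (j : ℕ) :
    MeasurableSet {ω | (j : ℕ∞) < N ω} :=
  h.measurable_N (.of_discrete (s := Ioi (j : ℕ∞)))

theorem IsPoissonProcess.lintegral_pointCount (h : IsPoissonProcess P N T ρ) {B : Set ℝ}
    (hB : MeasurableSet B) :
    ∫⁻ ω, (pointCount N T B ω : ℝ≥0∞) ∂P = intensity P N T B := by
  have hset (j : ℕ) : MeasurableSet {ω | (j : ℕ∞) < N ω ∧ T j ω ∈ B} :=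
    (h.measurableSet_lt j).inter (h.measurable_T j hB)
  have hrw (ω : Ω) : (pointCount N T B ω : ℝ≥0∞) =
      ∑' j : ℕ, {ω | (j : ℕ∞) < N ω ∧ T j ω ∈ B}.indicator (fun _ => (1 : ℝ≥0∞)) ω := by
    rw [pointCount, coe_encard_eq_tsum]
    rfl
  simp_rw [hrw]
  rw [lintegral_tsum fun j => (measurable_const.indicator (hset j)).aemeasurable, intensity,
    Measure.sum_apply _ hB]
  refine tsum_congr fun j => ?_
  rw [lintegral_indicator_const (hset j), one_mul, Measure.map_apply (h.measurable_T j) hB,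
    Measure.restrict_apply (h.measurable_T j hB)]
  congr 1
  ext ω
  exact and_comm

theorem IsPoissonProcess.measurable_pointCount (h : IsPoissonProcess P N T ρ) {B : Set ℝ}
    (hB : MeasurableSet B) : Measurable fun ω => (pointCount N T B ω : ℝ≥0∞) := by
  have hset (j : ℕ) : MeasurableSet {ω | (j : ℕ∞) < N ω ∧ T j ω ∈ B} :=
    (h.measurableSet_lt j).inter (h.measurable_T j hB)
  have hrw : (fun ω => (pointCount N T B ω : ℝ≥0∞)) = fun ω =>
      ∑' j : ℕ, {ω | (j : ℕ∞) < N ω ∧ T j ω ∈ B}.indicator (fun _ => (1 : ℝ≥0∞)) ω := by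
    funext ω
    rw [pointCount, coe_encard_eq_tsum]
    rfl
  rw [hrw]
  exact Measurable.tsum fun j => measurable_const.indicator (hset j)

/-- The Poisson masses at finite n already sum to 1, so the count is almost surely finite and its
expectation is the Poisson mean. -/
theorem IsPoissonProcess.intensity_apply [IsProbabilityMeasure P] (h : IsPoissonProcess P N T ρ)
    {B : Set ℝ} (hB : MeasurableSet B) (hpos : B ⊆ Ioi 0) (hfin : ρ B ≠ ⊤) :
    intensity P N T B = ρ B := by
  have hm := h.measurable_pointCount hB
  have hlaw (n : ℕ) : P {ω | (pointCount N T B ω : ℝ≥0∞) = n} =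
      poissonMeasure (ρ B).toNNReal {n} := by
    rw [← h.law B hB hpos hfin n]
    congr 1
    ext ω
    simp only [mem_ofPred_eq]
    norm_cast
  have hset (n : ℕ) : MeasurableSet {ω | (pointCount N T B ω : ℝ≥0∞) = n} :=
    hm (measurableSet_singleton _)
  have hdisj : Pairwise (Function.onFun Disjoint
      fun n : ℕ => {ω | (pointCount N T B ω : ℝ≥0∞) = n}) := by
    intro i j hij
    refine Set.disjoint_left.2 fun ω hi hj => hij ?_
    have : (i : ℝ≥0∞) = j := (show _ = _ from hi).symm.trans hj
    exact_mod_cast this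
  have hae : ∀ᵐ ω ∂P, ω ∈ ⋃ n : ℕ, {ω | (pointCount N T B ω : ℝ≥0∞) = n} := by
    refine (mem_ae_iff_prob_eq_one (MeasurableSet.iUnion hset)).2 ?_
    rw [measure_iUnion hdisj hset, ← tsum_poissonMeasure_singleton (ρ B).toNNReal]
    exact tsum_congr hlaw
  have hval : ∀ᵐ ω ∂P, (pointCount N T B ω : ℝ≥0∞) = ∑' n : ℕ,
      {ω | (pointCount N T B ω : ℝ≥0∞) = n}.indicator (fun _ => (n : ℝ≥0∞)) ω := by
    filter_upwards [hae] with ω hω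
    obtain ⟨n, hn⟩ := mem_iUnion.1 hω
    rw [tsum_eq_single n, indicator_of_mem hn]
    · exact hn
    · intro m hm
      exact indicator_of_notMem (fun hm' => Set.disjoint_left.1 (hdisj hm) hm' hn) _
  rw [← h.lintegral_pointCount hB, lintegral_congr_ae hval,
    lintegral_tsum fun n => (measurable_const.indicator (hset n)).aemeasurable]
  simp_rw [lintegral_indicator_const (hset _), hlaw]
  rw [tsum_natCast_mul_poissonMeasure, ENNReal.coe_toNNReal hfin]

/-- An upper bound is all that integrability of the weights needs, and it is trivial on sets of
infinite `ρ`-measure. -/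
theorem IsPoissonProcess.intensity_le [IsProbabilityMeasure P] (h : IsPoissonProcess P N T ρ) :
    intensity P N T ≤ ρ.restrict (Ioi 0) := by
  refine Measure.le_iff.2 fun B hB => ?_
  have hnull : intensity P N T (Iic 0) = 0 := by
    rw [← h.lintegral_pointCount measurableSet_Iic]
    have (ω : Ω) : pointCount N T (Iic 0) ω = 0 := by
      rw [pointCount, Set.encard_eq_zero]
      refine Set.eq_empty_of_forall_notMem fun j hj => ?_
      exact absurd hj.2 (not_le.2 (h.pos ω j hj.1))
    simp [this]
  have hsplit : intensity P N T B ≤ intensity P N T (B ∩ Ioi 0) := by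
    calc intensity P N T B ≤ intensity P N T ((B ∩ Ioi 0) ∪ Iic 0) :=
          measure_mono fun y hy => (lt_or_ge 0 y).imp (fun h => ⟨hy, h⟩) id
      _ ≤ _ := (measure_union_le _ _).trans (by rw [hnull, add_zero])
  rw [Measure.restrict_apply hB]
  refine hsplit.trans ?_
  by_cases hfin : ρ (B ∩ Ioi 0) = ⊤
  · simp [hfin]
  · exact (h.intensity_apply (hB.inter measurableSet_Ioi) inter_subset_right hfin).le

/-- The truncated points of the Poisson process have a finite sum. -/
theorem IsPoissonProcess.ae_tsum_weight_lt_top [IsProbabilityMeasure P]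
    (h : IsPoissonProcess P N T ρ)
    (hρ : ∫⁻ x in Ioi 0, ENNReal.ofReal (min 1 x) ∂ρ < ⊤) :
    ∀ᵐ ω ∂P, ∑' j, weight N T j ω < ⊤ := by
  have hmeas (j : ℕ) : Measurable (weight N T j) :=
    Measurable.indicator ((measurable_const.min (h.measurable_T j)).ennreal_ofReal)
      (h.measurableSet_lt j)
  refine ae_lt_top (Measurable.tsum hmeas) (ne_of_lt ?_)
  refine lt_of_le_of_lt ?_ hρ
  calc ∫⁻ ω, ∑' j, weight N T j ω ∂P
      = ∫⁻ x, ENNReal.ofReal (min 1 x) ∂(intensity P N T) := by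
        rw [lintegral_tsum fun j => (hmeas j).aemeasurable, intensity, lintegral_sum_measure]
        refine tsum_congr fun j => ?_
        rw [lintegral_map (by fun_prop) (h.measurable_T j), weight,
          lintegral_indicator (h.measurableSet_lt j)]
    _ ≤ _ := lintegral_mono' h.intensity_le le_rfl

end Points

/-! ### Conditioning on the covariance and the points. -/

section Layer

variable {Ω : Type*} {d : ℕ}
  {K : Ω → Matrix (Fin d) (Fin d) ℝ} {ρ : Measure ℝ} {N : Ω → ℕ∞} {T : ℕ → Ω → ℝ}
  {ζ : ℕ → Ω → EuclideanSpace ℝ (Fin d)}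

theorem measurable_layerSigma_weight (j : ℕ) : Measurable[layerSigma K N T] (weight N T j) := by
  let m := layerSigma K N T
  have hY : Measurable[m] fun ω => ((fun i i' => K ω i i'), N ω, fun j => T j ω) :=
    comap_measurable _
  have hN : Measurable[m] N := measurable_fst.comp (measurable_snd.comp hY)
  have hT : Measurable[m] (T j) :=
    (measurable_pi_apply j).comp (measurable_snd.comp (measurable_snd.comp hY))
  exact Measurable.indicator (measurable_const.min hT).ennreal_ofReal (hN (.of_discrete (s := Ioi (j : ℕ∞))))

variable [mΩ : MeasurableSpace Ω] {P : Measure Ω}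

/-- Otherwise the conditional expectation takes its default value 0, whereas `gaussian` with an
empty index set makes it the empty product 1. -/
theorem IsLayerInput.layerSigma_le [IsProbabilityMeasure P] (h : IsLayerInput P K ρ N T ζ) : layerSigma K N T ≤ mΩ := by
  by_contra hm
  have h0 := h.gaussian ∅ (fun _ => univ) fun _ => MeasurableSet.univ
  rw [condExp_of_not_le hm] at h0
  obtain ⟨ω, hω⟩ := h0.exists
  simp at hω

theorem IsLayerInput.real_eq_condExp (h : IsLayerInput P K ρ N T ζ) (j : ℕ)
    {C : Set (EuclideanSpace ℝ (Fin d))} (hC : MeasurableSet C) :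
    P⟦ζ j ⁻¹' C | layerSigma K N T⟧ =ᵐ[P] fun ω => (multivariateGaussian 0 (K ω)).real C := by
  simpa using h.gaussian {j} (fun _ => C) fun _ => hC

/-- Almost surely, the Gaussian sequence visits a given nonempty open set. -/
theorem IsLayerInput.ae_exists_mem [IsProbabilityMeasure P] (h : IsLayerInput P K ρ N T ζ)
    (hK : ∀ᵐ ω ∂P, (K ω).PosDef)
    {U : Set (EuclideanSpace ℝ (Fin d))} (hU : IsOpen U) (hne : U.Nonempty) :
    ∀ᵐ ω ∂P, ∃ j, ζ j ω ∈ U := by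
  have hm := h.layerSigma_le
  have hUc : MeasurableSet Uᶜ := hU.measurableSet.compl
  have hset (n : ℕ) : MeasurableSet (⋂ j ∈ Finset.range n, ζ j ⁻¹' Uᶜ) :=
    Finset.measurableSet_biInter _ fun j _ => h.measurable_ζ j hUc
  have hprob (n : ℕ) : P.real (⋂ j ∈ Finset.range n, ζ j ⁻¹' Uᶜ) =
      ∫ ω, (multivariateGaussian 0 (K ω)).real Uᶜ ^ n ∂P := by
    have h1 := h.gaussian (Finset.range n) (fun _ => Uᶜ) fun _ => hUc
    have h2 := integral_condExp (μ := P) hm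
      (f := (⋂ j ∈ Finset.range n, ζ j ⁻¹' Uᶜ).indicator fun _ => (1 : ℝ))
    rw [integral_congr_ae h1, integral_indicator_const _ (hset n)] at h2
    simpa using h2.symm
  have hae : AEStronglyMeasurable (fun ω => (multivariateGaussian 0 (K ω)).real Uᶜ) P :=
    (integrable_condExp.aestronglyMeasurable).congr (h.real_eq_condExp 0 hUc)
  -- The probability of avoiding `U` for n steps is the mean of the n-th power of a random number
  -- that is almost surely below 1.
  have hlim : Tendsto (fun n : ℕ => ∫ ω, (multivariateGaussian 0 (K ω)).real Uᶜ ^ n ∂P) atTop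
      (𝓝 (∫ _, (0 : ℝ) ∂P)) := by
    refine tendsto_integral_of_dominated_convergence (fun _ => 1) (fun n => hae.pow n)
      (integrable_const _) (fun n => ae_of_all _ fun ω => ?_) ?_
    · rw [Real.norm_of_nonneg (by positivity)]
      exact pow_le_one₀ measureReal_nonneg measureReal_le_one
    · filter_upwards [hK] with ω hω
      refine tendsto_pow_atTop_nhds_zero_of_lt_one measureReal_nonneg ?_
      have := isOpenPosMeasure_multivariateGaussian 0 hω
      rw [probReal_compl_eq_one_sub hU.measurableSet]
      have hpos : 0 < (multivariateGaussian 0 (K ω)).real U :=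
        ENNReal.toReal_pos (hU.measure_pos _ hne).ne' (measure_ne_top _ _)
      linarith
  have hle (n : ℕ) : P.real {ω | ¬ ∃ j, ζ j ω ∈ U} ≤
      ∫ ω, (multivariateGaussian 0 (K ω)).real Uᶜ ^ n ∂P := by
    rw [← hprob]
    refine measureReal_mono fun ω hω => mem_iInter₂.2 fun j _ hj => hω ⟨j, hj⟩
  have hzero : P.real {ω | ¬ ∃ j, ζ j ω ∈ U} ≤ 0 := by
    rw [integral_zero] at hlim
    exact ge_of_tendsto' hlim hle
  rw [ae_iff]
  exact (measureReal_eq_zero_iff).1 (le_antisymm hzero measureReal_nonneg)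

/-- Given `(K, N, T)`, each `ζ j` has the law `N(0, K)`: disintegration for nonnegative
functions. -/
theorem IsLayerInput.lintegral_mul [IsProbabilityMeasure P] (h : IsLayerInput P K ρ N T ζ)
    {f : EuclideanSpace ℝ (Fin d) → ℝ≥0∞} (hf : Measurable f) :
    ∃ g : Ω → ℝ≥0∞, Measurable[layerSigma K N T] g ∧
      (∀ᵐ ω ∂P, ∫⁻ z, f z ∂(multivariateGaussian 0 (K ω)) = g ω) ∧
      ∀ (j : ℕ) (w : Ω → ℝ≥0∞), Measurable[layerSigma K N T] w →
        ∫⁻ ω, w ω * f (ζ j ω) ∂P = ∫⁻ ω, w ω * g ω ∂P := by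
  have hm := h.layerSigma_le
  refine Measurable.ennreal_induction (motive := fun f => ∃ g : Ω → ℝ≥0∞,
      Measurable[layerSigma K N T] g ∧
      (∀ᵐ ω ∂P, ∫⁻ z, f z ∂(multivariateGaussian 0 (K ω)) = g ω) ∧
      ∀ (j : ℕ) (w : Ω → ℝ≥0∞), Measurable[layerSigma K N T] w →
        ∫⁻ ω, w ω * f (ζ j ω) ∂P = ∫⁻ ω, w ω * g ω ∂P) ?_ ?_ ?_ hf
  · intro c C hC
    -- All the `p j` are versions of the same Gaussian probability. Using `p 0` throughout gives a
    -- `g` that does not depend on `j` and is measurable for `layerSigma`.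
    let p (j : ℕ) : Ω → ℝ := P⟦ζ j ⁻¹' C | layerSigma K N T⟧
    have hp (j : ℕ) : Measurable[layerSigma K N T] (p j) := stronglyMeasurable_condExp.measurable
    have hp0 (j : ℕ) : p j =ᵐ[P] p 0 :=
      (h.real_eq_condExp j hC).trans (h.real_eq_condExp 0 hC).symm
    have hD (j : ℕ) : MeasurableSet (ζ j ⁻¹' C) := h.measurable_ζ j hC
    refine ⟨fun ω => c * ENNReal.ofReal (p 0 ω), (hp 0).ennreal_ofReal.const_mul c, ?_, ?_⟩
    · filter_upwards [h.real_eq_condExp 0 hC] with ω hω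
      rw [lintegral_indicator_const hC, show p 0 ω = _ from hω, ofReal_measureReal]
    · intro j w hw
      -- Since `w` is `layerSigma`-measurable, the two measures need only agree on that σ-algebra,
      -- where this is the defining property of conditional expectation.
      have hmeas : (P.restrict (ζ j ⁻¹' C)).trim hm =
          (P.withDensity fun ω => ENNReal.ofReal (p 0 ω)).trim hm := by
        refine @Measure.ext _ (layerSigma K N T) _ _ fun B hB => ?_
        rw [trim_measurableSet_eq hm hB, trim_measurableSet_eq hm hB,
          withDensity_apply _ (hm _ hB), Measure.restrict_apply (hm _ hB)]
        have hint : Integrable ((ζ j ⁻¹' C).indicator fun _ => (1 : ℝ)) P :=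
          (integrable_const _).indicator (hD j)
        have h1 := setIntegral_condExp hm hint hB
        have hnn : 0 ≤ᵐ[P.restrict B] p j := by
          refine ae_restrict_of_ae ?_
          filter_upwards [h.real_eq_condExp j hC] with ω hω
          rw [show p j ω = _ from hω]
          exact measureReal_nonneg
        rw [← setLIntegral_congr_fun_ae (hm _ hB) (f := fun ω => ENNReal.ofReal (p j ω))
            (by filter_upwards [hp0 j] with ω hω _; rw [hω]),
          ← ofReal_integral_eq_lintegral_ofReal integrable_condExp.integrableOn hnn, h1,
          setIntegral_indicator (hD j)]
        simp
      calc ∫⁻ ω, w ω * C.indicator (fun _ => c) (ζ j ω) ∂P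
          = ∫⁻ ω, c * w ω ∂(P.restrict (ζ j ⁻¹' C)) := by
            rw [← lintegral_indicator (hD j)]
            refine lintegral_congr fun ω => ?_
            by_cases hω : ζ j ω ∈ C
            · rw [indicator_of_mem hω, indicator_of_mem (s := ζ j ⁻¹' C) hω, mul_comm]
            · rw [indicator_of_notMem hω, indicator_of_notMem (s := ζ j ⁻¹' C) hω, mul_zero]
        _ = ∫⁻ ω, c * w ω ∂(P.withDensity fun ω => ENNReal.ofReal (p 0 ω)) := by
            rw [← lintegral_trim hm (hw.const_mul c), hmeas, lintegral_trim hm (hw.const_mul c)]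
        _ = _ := by
            rw [lintegral_withDensity_eq_lintegral_mul _ ((hp 0).mono hm le_rfl).ennreal_ofReal
              ((hw.const_mul c).mono hm le_rfl)]
            refine lintegral_congr fun ω => ?_
            simp only [Pi.mul_apply]
            ring
  · rintro f₁ f₂ - hf₁ hf₂ ⟨g₁, hg₁, hK₁, hw₁⟩ ⟨g₂, hg₂, hK₂, hw₂⟩
    refine ⟨g₁ + g₂, hg₁.add hg₂, ?_, fun j w hw => ?_⟩
    · filter_upwards [hK₁, hK₂] with ω h₁ h₂
      simp only [Pi.add_apply]
      rw [lintegral_add_left hf₁, h₁, h₂]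
    · simp only [Pi.add_apply, mul_add]
      have hwm := hw.mono hm le_rfl
      rw [lintegral_add_left (f := fun ω => w ω * f₁ (ζ j ω))
          (hwm.mul (hf₁.comp (h.measurable_ζ j))),
        lintegral_add_left (f := fun ω => w ω * g₁ ω) (hwm.mul (hg₁.mono hm le_rfl)), hw₁ j w hw, hw₂ j w hw]
  · intro f hf hmono ih
    choose g hg hKg hwg using ih
    have hall : ∀ᵐ ω ∂P, ∀ n, ∫⁻ z, f n z ∂(multivariateGaussian 0 (K ω)) = g n ω :=
      ae_all_iff.2 hKg
    refine ⟨fun ω => ⨆ n, g n ω, Measurable.iSup hg, ?_, fun j w hw => ?_⟩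
    · filter_upwards [hall] with ω hω
      rw [lintegral_iSup hf hmono]
      simp_rw [hω]
    · have hwm := hw.mono hm le_rfl
      simp only [ENNReal.mul_iSup]
      -- The `g n` are only versions of the Gaussian integrals, hence increasing only almost
      -- everywhere; this calls for the almost-everywhere form of monotone convergence.
      rw [lintegral_iSup (f := fun n ω => w ω * f n (ζ j ω)) (fun n => hwm.mul ((hf n).comp (h.measurable_ζ j)))
          (fun a b hab ω => mul_le_mul_right (hmono hab _) _),
        lintegral_iSup_ae (f := fun n ω => w ω * g n ω) (fun n => hwm.mul ((hg n).mono hm le_rfl))]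
      · exact iSup_congr fun n => hwg n j w hw
      · intro n
        filter_upwards [hall] with ω hω
        simp only [← hω]
        gcongr
        exact hmono (Nat.le_succ n) _

/-- Randomly weighted sums of integrable functions of the Gaussian sequence are finite. -/
theorem IsLayerInput.ae_tsum_mul_lt_top [IsProbabilityMeasure P] (h : IsLayerInput P K ρ N T ζ)
    {f : EuclideanSpace ℝ (Fin d) → ℝ≥0∞} (hf : Measurable f)
    (hfin : ∀ S : Matrix (Fin d) (Fin d) ℝ, ∫⁻ z, f z ∂(multivariateGaussian 0 S) < ⊤)
    {w : ℕ → Ω → ℝ≥0∞} (hw : ∀ j, Measurable[layerSigma K N T] (w j))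
    (hwfin : ∀ᵐ ω ∂P, ∑' j, w j ω < ⊤) :
    ∀ᵐ ω ∂P, ∑' j, w j ω * f (ζ j ω) < ⊤ := by
  have hm := h.layerSigma_le
  obtain ⟨g, hg, hKg, hwg⟩ := h.lintegral_mul hf
  let W : Ω → ℝ≥0∞ := fun ω => ∑' j, w j ω
  have hW : Measurable[layerSigma K N T] W := @Measurable.tsum _ _ _ (_) _ _ _ _ _ _ _ _ _ _ _ _ hw
  -- The conditional mean `W * g` of the sum is almost surely finite but need not be integrable. The
  -- factor `b` brings the expectation below 1 and is almost surely positive, so it can be removed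
  -- afterwards.
  let b : Ω → ℝ≥0∞ := fun ω => (1 + W ω * g ω)⁻¹
  have hb : Measurable[layerSigma K N T] b := ((hW.mul hg).const_add 1).inv
  have hterm (j : ℕ) : Measurable fun ω => b ω * w j ω * f (ζ j ω) :=
    ((hb.mul (hw j)).mono hm le_rfl).mul (hf.comp (h.measurable_ζ j))
  have hbound : ∫⁻ ω, ∑' j, b ω * w j ω * f (ζ j ω) ∂P ≤ 1 := by
    calc ∫⁻ ω, ∑' j, b ω * w j ω * f (ζ j ω) ∂P
        = ∑' j, ∫⁻ ω, b ω * w j ω * g ω ∂P := by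
          rw [lintegral_tsum fun j => (hterm j).aemeasurable]
          exact tsum_congr fun j => hwg j _ (hb.mul (hw j))
      _ = ∫⁻ ω, b ω * (W ω * g ω) ∂P := by
          rw [← lintegral_tsum (f := fun j ω => b ω * w j ω * g ω) fun j =>
            (((hb.mul (hw j)).mul hg).mono hm le_rfl).aemeasurable]
          refine lintegral_congr fun ω => ?_
          rw [ENNReal.tsum_mul_right, ENNReal.tsum_mul_left, mul_assoc]
      _ ≤ ∫⁻ _, 1 ∂P := by
          refine lintegral_mono fun ω => ?_
          calc b ω * (W ω * g ω) ≤ b ω * (1 + W ω * g ω) := by gcongr; exact le_add_self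
            _ ≤ 1 := ENNReal.inv_mul_le_one _
      _ = 1 := by simp
  have hfinite := ae_lt_top (Measurable.tsum hterm)
    (ne_top_of_le_ne_top ENNReal.one_ne_top hbound)
  filter_upwards [hfinite, hKg, hwfin] with ω h1 h2 h3
  have hg' : g ω ≠ ⊤ := h2 ▸ (hfin _).ne
  have hb0 : b ω ≠ 0 := by
    simp only [b, ne_eq, ENNReal.inv_eq_zero]
    exact ENNReal.add_ne_top.2 ⟨ENNReal.one_ne_top, ENNReal.mul_ne_top h3.ne hg'⟩
  simp_rw [mul_assoc, ENNReal.tsum_mul_left] at h1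
  by_contra htop
  rw [not_lt, top_le_iff] at htop
  rw [htop, ENNReal.mul_top hb0] at h1
  exact lt_irrefl _ h1

end Layer

/-! ### Convergence of the random series. -/

section Summability

variable {Ω : Type*} {d : ℕ}
  {K : Ω → Matrix (Fin d) (Fin d) ℝ} {ρ : Measure ℝ} {N : Ω → ℕ∞} {T : ℕ → Ω → ℝ}
  {ζ : ℕ → Ω → EuclideanSpace ℝ (Fin d)} {σ : ℝ → ℝ}

theorem summable_jumpTerm_of_tsum_lt_top (ω : Ω) (hpos : ∀ j : ℕ, (j : ℕ∞) < N ω → 0 < T j ω)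
    (hw : ∑' j, weight N T j ω < ⊤)
    (hwσ : ∑' j, weight N T j ω * ENNReal.ofReal (∑ i, σ (ζ j ω i) ^ 2) < ⊤) :
    Summable (jumpTerm σ N T ζ ω) := by
  have hweight (j : {j : ℕ // (j : ℕ∞) < N ω}) :
      weight N T j ω = ENNReal.ofReal (min 1 (T j ω)) :=
    indicator_of_mem (s := {ω | ((j : ℕ) : ℕ∞) < N ω}) j.2 _
  have hmin (j : {j : ℕ // (j : ℕ∞) < N ω}) : 0 ≤ min 1 (T j ω) :=
    le_min zero_le_one (hpos j j.2).le
  have hsub {u : ℕ → ℝ≥0∞} (hu : ∑' j, u j < ⊤) :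
      Summable fun j : {j : ℕ // (j : ℕ∞) < N ω} => (u j).toReal :=
    ENNReal.summable_toReal
      ((ENNReal.tsum_comp_le_tsum_of_injective Subtype.val_injective u).trans_lt hu).ne
  have h1 : Summable fun j : {j : ℕ // (j : ℕ∞) < N ω} => min 1 (T j ω) := by
    refine (hsub hw).congr fun j => ?_
    rw [hweight, ENNReal.toReal_ofReal (hmin j)]
  have h2 : Summable fun j : {j : ℕ // (j : ℕ∞) < N ω} =>
      min 1 (T j ω) * ∑ i, σ (ζ j ω i) ^ 2 := by
    refine (hsub hwσ).congr fun j => ?_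
    rw [hweight, ENNReal.toReal_mul, ENNReal.toReal_ofReal (hmin j),
      ENNReal.toReal_ofReal (by positivity)]
  -- The truncated weights tend to 0, so truncation alters only finitely many terms.
  have h3 : Summable fun j : {j : ℕ // (j : ℕ∞) < N ω} => T j ω * ∑ i, σ (ζ j ω i) ^ 2 := by
    refine h2.congr_cofinite ?_
    filter_upwards [h1.tendsto_cofinite_zero.eventually_lt_const one_pos] with j hj
    rw [min_eq_right]
    by_contra! hlt
    rw [min_eq_left hlt.le] at hj
    exact lt_irrefl _ hj
  refine Pi.summable.2 fun i => Pi.summable.2 fun k => ?_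
  refine Summable.of_norm_bounded h3 fun j => ?_
  have hT := hpos j j.2
  change ‖T j ω * (σ (ζ j ω i) * σ (ζ j ω k))‖ ≤ _
  rw [norm_mul, Real.norm_of_nonneg hT.le]
  refine mul_le_mul_of_nonneg_left ?_ hT.le
  have hi := Finset.single_le_sum (f := fun i => σ (ζ j ω i) ^ 2) (fun _ _ => sq_nonneg _)
    (Finset.mem_univ i)
  have hk := Finset.single_le_sum (f := fun i => σ (ζ j ω i) ^ 2) (fun _ _ => sq_nonneg _)
    (Finset.mem_univ k)
  simp only at hi hk
  rw [Real.norm_eq_abs, abs_le]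
  constructor <;> nlinarith [sq_nonneg (σ (ζ j ω i) + σ (ζ j ω k)),
    sq_nonneg (σ (ζ j ω i) - σ (ζ j ω k))]

/-- The series of one step of the recurrence converges almost surely. -/
theorem IsLayerInput.ae_summable_jumpTerm [MeasurableSpace Ω] {P : Measure Ω} [IsProbabilityMeasure P]
    (h : IsLayerInput P K ρ N T ζ) (hσ : Continuous σ)
    (hgrowth : ∃ a₁ a₂ a₃ : ℝ, 0 < a₁ ∧ 0 < a₂ ∧ 0 < a₃ ∧ ∀ z : ℝ, |σ z| ≤ a₁ + a₂ * |z| ^ a₃)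
    (hρ : ∫⁻ x in Ioi 0, ENNReal.ofReal (min 1 x) ∂ρ < ⊤) :
    ∀ᵐ ω ∂P, Summable (jumpTerm σ N T ζ ω) := by
  have hweight := h.poisson.ae_tsum_weight_lt_top hρ
  have hsum := h.ae_tsum_mul_lt_top (w := weight N T)
    (f := fun z => ENNReal.ofReal (∑ i, σ (z i) ^ 2))
    (by fun_prop) (fun S => Integrable.lintegral_lt_top
      (integrable_finsetSum _ fun i _ => (memLp_activation hσ hgrowth S i).integrable_sq))
    measurable_layerSigma_weight hweight
  filter_upwards [hweight, hsum] with ω h1 h2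
  exact summable_jumpTerm_of_tsum_lt_top ω (h.poisson.pos ω) h1 h2

end Summability

/-! ### Positive definiteness and the step of the recurrence. -/

section PosDef

variable {d : ℕ}

theorem hasSum_quadForm {ι : Type*} {M : ι → Matrix (Fin d) (Fin d) ℝ}
    {S : Matrix (Fin d) (Fin d) ℝ} (h : HasSum M S) (v : Fin d → ℝ) :
    HasSum (fun j => v ⬝ᵥ (M j).mulVec v) (v ⬝ᵥ S.mulVec v) := by
  let q : Matrix (Fin d) (Fin d) ℝ →+ ℝ :=
    { toFun := fun A => v ⬝ᵥ A.mulVec v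
      map_zero' := by simp
      map_add' := fun A B => by rw [Matrix.add_mulVec, dotProduct_add] }
  have hq : Continuous q := by
    change Continuous fun A : Matrix (Fin d) (Fin d) ℝ => v ⬝ᵥ A.mulVec v
    fun_prop
  exact h.map q hq

theorem posSemidef_of_const_one :
    (Matrix.of fun _ _ => (1 : ℝ) : Matrix (Fin d) (Fin d) ℝ).PosSemidef := by
  refine .of_dotProduct_mulVec_nonneg (Matrix.IsHermitian.ext fun i j => by simp) fun v => ?_
  rw [star_trivial]
  have : v ⬝ᵥ (Matrix.of fun _ _ => (1 : ℝ) : Matrix (Fin d) (Fin d) ℝ).mulVec v =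
      (∑ i, v i) * ∑ i, v i := by
    simp [dotProduct, Matrix.mulVec, Finset.sum_mul]
  rw [this]
  exact mul_self_nonneg _

theorem posDef_covFirst {n₀ : ℕ} {CB CW : ℝ} (hCB : 0 ≤ CB) (hCW : 0 < CW) (hd : d ≤ n₀)
    {x : Fin d → EuclideanSpace ℝ (Fin n₀)} (hx : LinearIndependent ℝ x) :
    (covFirst CB CW x).PosDef := by
  -- The normalisation divides by `n₀`; if it vanishes, so does `d`, and the matrix is empty.
  rcases Nat.eq_zero_or_pos n₀ with rfl | hn
  · obtain rfl : d = 0 := Nat.le_zero.1 hd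
    exact .of_dotProduct_mulVec_pos (Matrix.IsHermitian.ext fun i => i.elim0)
      fun v hv => (hv (Subsingleton.elim _ _)).elim
  · have hn' : (0 : ℝ) < n₀ := by exact_mod_cast hn
    have heq : covFirst CB CW x =
        CB • Matrix.of (fun _ _ => (1 : ℝ)) + (CW / n₀) • Matrix.gram ℝ x := by
      ext i j
      simp only [covFirst, Matrix.of_apply, Matrix.add_apply, Matrix.smul_apply,
        Matrix.gram_apply, smul_eq_mul]
      ring
    rw [heq]
    exact Matrix.PosDef.posSemidef_add (posSemidef_of_const_one.smul hCB)
      ((Matrix.posDef_gram_of_linearIndependent hx).smul (div_pos hCW hn'))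

variable {Ω : Type*} {N : Ω → ℕ∞} {T : ℕ → Ω → ℝ} {ζ : ℕ → Ω → EuclideanSpace ℝ (Fin d)}
  {σ : ℝ → ℝ}

theorem posSemidef_jumpTerm {ω : Ω} (hpos : ∀ j : ℕ, (j : ℕ∞) < N ω → 0 < T j ω)
    (j : {j : ℕ // (j : ℕ∞) < N ω}) : (jumpTerm σ N T ζ ω j).PosSemidef :=
  (posSemidef_actOuter _).smul (hpos j j.2).le

theorem isHermitian_tsum_jumpTerm {ω : Ω} (hpos : ∀ j : ℕ, (j : ℕ∞) < N ω → 0 < T j ω) :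
    (∑' j, jumpTerm σ N T ζ ω j).IsHermitian := by
  rw [Matrix.IsHermitian, Matrix.conjTranspose_tsum]
  exact tsum_congr fun j => (posSemidef_jumpTerm hpos j).isHermitian

theorem posSemidef_tsum_jumpTerm {ω : Ω} (hpos : ∀ j : ℕ, (j : ℕ∞) < N ω → 0 < T j ω)
    (hsum : Summable (jumpTerm σ N T ζ ω)) : (∑' j, jumpTerm σ N T ζ ω j).PosSemidef := by
  refine .of_dotProduct_mulVec_nonneg (isHermitian_tsum_jumpTerm hpos) fun v => ?_
  refine (hasSum_quadForm hsum.hasSum v).nonneg fun j => ?_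
  exact (posSemidef_jumpTerm hpos j).dotProduct_mulVec_nonneg v

/-- For each v the quadratic form is a sum of nonnegative terms T_j ⟨v, σ(ζ_j)⟩², so one nonzero
term is enough. -/
theorem posDef_tsum_jumpTerm {ω : Ω} (hpos : ∀ j : ℕ, (j : ℕ∞) < N ω → 0 < T j ω)
    (hsum : Summable (jumpTerm σ N T ζ ω))
    (hspan : ∀ v : Fin d → ℝ, v ≠ 0 →
      ∃ j : ℕ, (j : ℕ∞) < N ω ∧ ∑ i, v i * σ (ζ j ω i) ≠ 0) :
    (∑' j, jumpTerm σ N T ζ ω j).PosDef := by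
  refine .of_dotProduct_mulVec_pos (isHermitian_tsum_jumpTerm hpos) fun v hv => ?_
  obtain ⟨j, hj, hne⟩ := hspan v hv
  have hs := hasSum_quadForm hsum.hasSum v
  rw [star_trivial, ← hs.tsum_eq]
  refine hs.summable.tsum_pos (fun k => ?_) ⟨j, hj⟩ ?_
  · exact (posSemidef_jumpTerm hpos k).dotProduct_mulVec_nonneg v
  · change 0 < v ⬝ᵥ (T j ω • actOuter σ (ζ j ω)).mulVec v
    rw [Matrix.smul_mulVec, dotProduct_smul, quadForm_actOuter, smul_eq_mul]
    exact mul_pos (hpos j hj) (by positivity)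

theorem eq_top_of_pointCount_eq_top {B : Set ℝ} {ω : Ω} (h : pointCount N T B ω = ⊤) :
    N ω = ⊤ := by
  by_contra hN
  obtain ⟨n, hn⟩ := ENat.ne_top_iff_exists.1 hN
  rw [pointCount, Set.encard_eq_top_iff] at h
  refine h ((Set.finite_Iio n).subset fun j hj => ?_)
  have := hj.1
  rw [← hn] at this
  exact_mod_cast this

variable [MeasurableSpace Ω] {P : Measure Ω} [IsProbabilityMeasure P]
  {K : Ω → Matrix (Fin d) (Fin d) ℝ} {ρ : Measure ℝ}

/-- One step of the recurrence preserves almost sure positive definiteness. -/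
theorem IsLayerInput.ae_posDef_step (h : IsLayerInput P K ρ N T ζ)
    {CB CW a : ℝ} (hCB : 0 ≤ CB) (hCW : 0 < CW) (ha : 0 ≤ a) (hσ : Continuous σ)
    (hgrowth : ∃ a₁ a₂ a₃ : ℝ, 0 < a₁ ∧ 0 < a₂ ∧ 0 < a₃ ∧ ∀ z : ℝ, |σ z| ≤ a₁ + a₂ * |z| ^ a₃)
    {A : Set (EuclideanSpace ℝ (Fin d))} (hA : 0 < volume (act σ '' A))
    (hρ : ∫⁻ x in Ioi 0, ENNReal.ofReal (min 1 x) ∂ρ < ⊤)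
    (hinf : a = 0 → ∀ᵐ ω ∂P, pointCount N T (Ioi 0) ω = ⊤)
    (hK : ∀ᵐ ω ∂P, (K ω).PosDef) :
    ∀ᵐ ω ∂P, (CB • Matrix.of (fun _ _ => (1 : ℝ)) +
      CW • (a • gaussOuter σ (K ω) + ∑' j, jumpTerm σ N T ζ ω j)).PosDef := by
  have hsum := h.ae_summable_jumpTerm hσ hgrowth hρ
  have hone := (posSemidef_of_const_one (d := d)).smul hCB
  rcases ha.eq_or_lt with ha0 | ha0
  · obtain ⟨t, U, hU, hcover⟩ := exists_finite_open_cover hσ hA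
    have hvisit : ∀ᵐ ω ∂P, ∀ u ∈ t, ∃ j, ζ j ω ∈ U u :=
      (Finset.eventually_all t).2 fun u hu => h.ae_exists_mem hK (hU u hu).1 (hU u hu).2
    filter_upwards [hsum, hvisit, hinf ha0.symm] with ω hsω hvω hNω
    -- The index at which the sequence visits a set is not bounded in advance, so every label must
    -- carry a point.
    have hN := eq_top_of_pointCount_eq_top hNω
    rw [← ha0, zero_smul, zero_add]
    refine Matrix.PosDef.posSemidef_add hone
      ((posDef_tsum_jumpTerm (h.poisson.pos ω) hsω fun v hv => ?_).smul hCW)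
    obtain ⟨u, hu, hne⟩ := hcover v hv
    obtain ⟨j, hj⟩ := hvω u hu
    exact ⟨j, hN ▸ ENat.natCast_lt_top j, hne _ hj⟩
  · filter_upwards [hsum, hK] with ω hsω hKω
    exact Matrix.PosDef.posSemidef_add hone ((((posDef_gaussOuter hσ hgrowth hA hKω).smul
      ha0).add_posSemidef (posSemidef_tsum_jumpTerm (h.poisson.pos ω) hsω)).smul hCW)

end PosDef

end WideNet
-- Induction over the layers.
theorem theorem6p1 {Ω : Type*} [MeasurableSpace Ω] (P : Measure Ω) [IsProbabilityMeasure P]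
    (L n₀ d : ℕ) (CB CW : ℝ) (hCB : 0 ≤ CB) (hCW : 0 < CW)
    (x : Fin d → EuclideanSpace ℝ (Fin n₀))
    (σ : ℝ → ℝ)
    (M : ℕ → ℕ → ProbabilityMeasure ℝ) (a : ℕ → ℝ) (ρ : ℕ → Measure ℝ)
    -- the random inputs of the recurrence that defines the covariance matrices
    (N : ℕ → Ω → ℕ∞) (T : ℕ → ℕ → Ω → ℝ) (ζ : ℕ → ℕ → Ω → EuclideanSpace ℝ (Fin d))
    (hinput : ∀ ℓ ∈ Finset.Icc 1 L,
      WideNet.IsLayerInput P (WideNet.cov CB CW σ x a N T ζ ℓ) (ρ ℓ) (N ℓ) (T ℓ) (ζ ℓ))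
    -- (i) continuity and polynomial growth of the activation function
    (hσ : Continuous σ)
    (hgrowth : ∃ a₁ a₂ a₃ : ℝ, 0 < a₁ ∧ 0 < a₂ ∧ 0 < a₃ ∧ ∀ z : ℝ, |σ z| ≤ a₁ + a₂ * |z| ^ a₃)
    -- (ii) the sums of the variances converge to `ID(a, ρ)` at each hidden layer
    (hID : ∀ ℓ ∈ Finset.Icc 1 L, WideNet.RowSumsTendToID (M ℓ) (a ℓ) (ρ ℓ))
    -- a Borel set of positive Lebesgue measure whose image has positive Lebesgue measure
    (hA : ∃ A : Set (EuclideanSpace ℝ (Fin d)), MeasurableSet A ∧ 0 < volume A ∧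
      0 < volume (WideNet.act σ '' A))
    -- linearly independent data
    (hd : d ≤ n₀) (hx : LinearIndependent ℝ x)
    -- infinitely many Poisson points at each layer without drift
    (hinf : ∀ ℓ ∈ Finset.Icc 1 L, a ℓ = 0 →
      ∀ᵐ ω ∂P, WideNet.pointCount (N ℓ) (T ℓ) (Ioi 0) ω = ⊤) :
    -- the series that define the covariance matrices converge almost surely
    (∀ᵐ ω ∂P, ∀ ℓ ∈ Finset.Icc 1 L, Summable (WideNet.jumpTerm σ (N ℓ) (T ℓ) (ζ ℓ) ω)) ∧
    -- and the last covariance matrix is almost surely positive definite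
    (∀ᵐ ω ∂P, (WideNet.cov CB CW σ x a N T ζ (L + 1) ω).PosDef ∧
      0 < (WideNet.cov CB CW σ x a N T ζ (L + 1) ω).det) := by
  obtain ⟨A, -, -, hA⟩ := hA
  have hpos : ∀ ℓ ≤ L, ∀ᵐ ω ∂P, (WideNet.cov CB CW σ x a N T ζ (ℓ + 1) ω).PosDef := by
    intro ℓ
    induction ℓ with
    | zero => exact fun _ => ae_of_all _ fun _ => WideNet.posDef_covFirst hCB hCW hd hx
    | succ ℓ ih =>
      intro hℓ
      have hmem : ℓ + 1 ∈ Finset.Icc 1 L := Finset.mem_Icc.2 ⟨by omega, hℓ⟩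
      obtain ⟨-, μ, hμ, -⟩ := hID _ hmem
      exact (hinput _ hmem).ae_posDef_step hCB hCW hμ.drift_nonneg hσ hgrowth hA
        hμ.levy_integrable (hinf _ hmem) (ih (by omega))
  refine ⟨?_, ?_⟩
  · refine (Finset.eventually_all _).2 fun ℓ hℓ => ?_
    obtain ⟨-, μ, hμ, -⟩ := hID ℓ hℓ
    exact (hinput ℓ hℓ).ae_summable_jumpTerm hσ hgrowth hμ.levy_integrable
  · filter_upwards [hpos L le_rfl] with ω hω
    exact ⟨hω, hω.det_pos⟩
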